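/- Let $\alpha\in(0,1)$, $T>0$, $\eta\in\mathbb{R}^m$ and $f:[0,T]\times\mathbb{R}^m\to\mathbb{R}^m$. For $\rho\in\mathbb{R}^m$ let $y(\cdot,\rho)$ denote the continuous solution on $[0,T]$ of the fractional initial value problem $$y^{(\alpha)}(t,\rho)=f(t,y(t,\rho)),\qquad y(0,\rho)=\rho,$$ and let $\Phi(\cdot,\rho)$, with values in $\mathbb{R}^{m\times m}$, denote the continuous solution on $[0,T]$ of the variational problem $$\Phi^{(\alpha)}(t,\rho)=f'(t,y(t,\rho))\,\Phi(t,\rho),\qquad \Phi(0,\rho)=I,$$ where $f'$ is the Jacobian matrix of $f(t,y)$ with respect to $y$ and $g^{(\alpha)}$ is the Caputo derivative of order $\alpha$ of $g$, that is $$g^{(\alpha)}(t)=\frac{\mathrm d}{\mathrm dt}\,\frac1{\Gamma(1-\alpha)}\int_0^t(t-x)^{-\alpha}\,[g(x)-g(0)]\,\mathrm dx,$$ which equals $\frac1{\Gamma(1-\alpha)}\int_0^t(t-x)^{-\alpha}g'(x)\,\mathrm dx$ for almost every $t$ if $g$ is absolutely continuous. Suppose that $\rho^*\in\mathbb{R}^m$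 is such that the solution $y(\cdot,\rho^*)$ exists on $[0,T]$ with $y(T,\rho^*)=\eta$, that $\det\Phi(T,\rho^*)\neq0$, and that (i) in a neighbourhood, relative to $[0,T]\times\mathbb{R}^m$, of the trajectory $\{(t,y(t,\rho^*)):t\in[0,T]\}$, $f$ is continuous and continuously differentiable with respect to $y$ (that is, the Jacobian $f'$ exists and is continuous in $(t,y)$); (ii) $\xi\mapsto\Phi(T,\xi)^{-1}$ is differentiable in a neighbourhood of $\rho^*$. Then the shooting-Newton procedure $$\rho_{\ell+1}=\Psi(\rho_\ell),\qquad \Psi(\rho):=\rho-\Phi(T,\rho)^{-1}\,[\,y(T,\rho)-\eta\,],\qquad \ell=0,1,\dots,$$ converges in a suitable neighbourhood of $\rho^*$: there is $\delta>0$ such that for every $\rho$ with $\|\rho-\rho^*\|<\delta$ the two problems above have exactly one solution and $\det\Phi(T,\rho)\ne0$, and for every $\rho_0$ with $\|\rho_0-\rho^*\|<\delta$ all the iterates $\rho_\ell$ stay in this ball and $\rho_\ell\to\rho^*$ as $\ell\to\infty$. The convergence is exponential: there is $q\in(0,1)$ with $\|\rho_\ell-\rho^*\|\le q^\ell\|\rho_0-\rho^*\|$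 for all such $\rho_0$ and all $\ell$. Moreover, the Jacobian of $\Psi$ exists and vanishes at $\rho^*$. -/

import Mathlib

open Set Filter Topology

noncomputable section

/-- The Riemann-Liouville integral `I^β g (t) = 1/Γ(β) ∫₀ᵗ (t - x)^(β - 1) g(x) dx`. -/
def rlIntegral {V : Type*} [NormedAddCommGroup V] [NormedSpace ℝ V]
    (β : ℝ) (g : ℝ → V) (t : ℝ) : V :=
  (Real.Gamma β)⁻¹ • ∫ x in (0 : ℝ)..t, (t - x) ^ (β - 1) • g x

/-- `g` has on `[0, T]` at the point `t` the Caputo derivative `v` of order `α ∈ (0, 1)`, that is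
`d/dt I^(1 - α) (g - g 0) = v` (one-sided at the end points of `[0, T]`). For absolutely
continuous `g` one has `I^(1 - α) (g - g 0) (t) = ∫₀ᵗ I^(1 - α) g' (s) ds`, so that this is
`1/Γ(1 - α) ∫₀ᵗ (t - x)^(-α) g'(x) dx`; but it does not ask `g` to be differentiable, which
solutions of linear equations with merely continuous coefficients need not be. -/
def HasCaputoDerivAt {V : Type*} [NormedAddCommGroup V] [NormedSpace ℝ V]
    (α T : ℝ) (g : ℝ → V) (v : V) (t : ℝ) : Prop :=
  HasDerivWithinAt (rlIntegral (1 - α) (fun x => g x - g 0)) v (Icc 0 T) t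

/-- `y` is a solution on `[0, T]` of the fractional initial value problem
`y^(α)(t) = F(t, y(t))`, `y(0) = y₀`. -/
structure IsCaputoSolution {V : Type*} [NormedAddCommGroup V] [NormedSpace ℝ V]
    (α T : ℝ) (F : ℝ → V → V) (y₀ : V) (y : ℝ → V) : Prop where
  continuousOn : ContinuousOn y (Icc 0 T)
  initial : y 0 = y₀
  equation : ∀ t ∈ Icc 0 T, HasCaputoDerivAt α T y (F t (y t)) t

/-- The fractional initial value problem has exactly one solution on `[0, T]`. -/
def HasUniqueCaputoSolution {V : Type*} [NormedAddCommGroup V] [NormedSpace ℝ V]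
    (α T : ℝ) (F : ℝ → V → V) (y₀ : V) : Prop :=
  ∃ y, IsCaputoSolution α T F y₀ y ∧ ∀ z, IsCaputoSolution α T F y₀ z → EqOn z y (Icc 0 T)

open scoped Classical in
/-- A solution of the fractional initial value problem (the zero function if there is none). -/
def caputoSolution {V : Type*} [NormedAddCommGroup V] [NormedSpace ℝ V]
    (α T : ℝ) (F : ℝ → V → V) (y₀ : V) : ℝ → V :=
  if h : ∃ y, IsCaputoSolution α T F y₀ y then h.choose else 0

/-- The right-hand side `(t, X) ↦ f'(t, y(t, ρ)) X` of the variational problem, where `f'` is the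
Jacobian of `f` with respect to its second argument. -/
def variationalField {E : Type*} [NormedAddCommGroup E] [NormedSpace ℝ E]
    (α T : ℝ) (f : ℝ → E → E) (ρ : E) (t : ℝ) (X : E →L[ℝ] E) : E →L[ℝ] E :=
  (fderiv ℝ (f t) (caputoSolution α T f ρ t)).comp X

/-- The solution `Φ(t, ρ)` of the variational problem
`Φ^(α)(t, ρ) = f'(t, y(t, ρ)) Φ(t, ρ)`, `Φ(0, ρ) = I`. -/
def variationalSolution {E : Type*} [NormedAddCommGroup E] [NormedSpace ℝ E]
    (α T : ℝ) (f : ℝ → E → E) (ρ : E) : ℝ → (E →L[ℝ] E) :=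
  caputoSolution α T (variationalField α T f ρ) (ContinuousLinearMap.id ℝ E)

/-- One step `ρ ↦ ρ - Φ(T, ρ)⁻¹ [y(T, ρ) - η]` of the shooting-Newton procedure. -/
def shootingNewton {E : Type*} [NormedAddCommGroup E] [NormedSpace ℝ E]
    (α T : ℝ) (f : ℝ → E → E) (η ρ : E) : E :=
  ρ - (variationalSolution α T f ρ T).inverse (caputoSolution α T f ρ T - η)

/-- In a neighbourhood of the graph of `y` over `[0, T]`, relative to `[0, T] × E`, the function
`f(t, x)` is continuous and has a continuous Jacobian with respect to `x`. For an `f` that does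
not depend on `t` this says that `f` is `C¹` in a neighbourhood of `y([0, T])`. -/
def IsC1NearTrajectory {E : Type*} [NormedAddCommGroup E] [NormedSpace ℝ E]
    (T : ℝ) (f : ℝ → E → E) (y : ℝ → E) : Prop :=
  ∃ U : Set (ℝ × E), IsOpen U ∧ (∀ t ∈ Icc 0 T, (t, y t) ∈ U) ∧
    ContinuousOn (fun p : ℝ × E => f p.1 p.2) (U ∩ Icc 0 T ×ˢ univ) ∧
    (∀ p ∈ U ∩ Icc 0 T ×ˢ univ, DifferentiableAt ℝ (f p.1) p.2) ∧
    ContinuousOn (fun p : ℝ × E => fderiv ℝ (f p.1) p.2) (U ∩ Icc 0 T ×ˢ univ)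

end

/-! By Abel inversion, `I^(1-α) I^α = I^1`, the Caputo problem is equivalent to the Volterra
equation `z = y₀ + I^α F(·, z)`. In the weighted sup norm `sup e^(-λt) ‖w(t)‖` the operator `I^α`
has norm at most `λ^(-α)`. For large `λ` this gives a Gronwall inequality
(`norm_le_of_norm_le_add_rlIntegral`) and makes the Volterra operator a contraction near a known
solution. Hence the problem is uniquely solvable for initial values near `ρ*`, with Lipschitz
dependence on them.

With `h = ρ - ρ*`, the remainder `w = y(·, ρ) - y(·, ρ*) - Φ(·, ρ*) h` satisfies `w = I^α(f' w +
Taylor error)`, and the Taylor error is `o(‖h‖)` uniformly in `t`. Gronwall gives `w = o(‖h‖)`, so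
`ρ ↦ y(T, ρ)` has derivative `Φ(T, ρ*)` at `ρ*` (`IsC1OnTube.hasFDerivAt_caputoSolution`).

By the product rule `Ψ'(ρ*) = I - Φ⁻¹ Φ = 0`: the term with the derivative of `Φ⁻¹` is applied to
`y(T, ρ*) - η = 0`. A fixed point with zero derivative attracts a whole ball, with factor `1/2`. -/

/-! ### Riemann-Liouville integrals and Abel inversion. -/

section RiemannLiouville

open MeasureTheory

lemma integral_beta_kernel_zero_one {β : ℝ} (hβ : β ∈ Ioo (0 : ℝ) 1) :
    ∫ v in (0 : ℝ)..1, (1 - v) ^ (-β) * v ^ (β - 1) = Real.Gamma β * Real.Gamma (1 - β) := by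
  have h1 := ProbabilityTheory.beta_eq_betaIntegralReal β (1 - β) hβ.1 (by linarith [hβ.2])
  rw [ProbabilityTheory.beta, add_sub_cancel, Real.Gamma_one, div_one] at h1
  rw [h1, Complex.betaIntegral]
  have h2 : (∫ v in (0 : ℝ)..1, (v : ℂ) ^ ((β : ℂ) - 1) * (1 - (v : ℂ)) ^ (((1 - β : ℝ) : ℂ) - 1))
      = ∫ v in (0 : ℝ)..1, (((1 - v) ^ (-β) * v ^ (β - 1) : ℝ) : ℂ) := by
    refine intervalIntegral.integral_congr fun v hv => ?_
    rw [uIcc_of_le zero_le_one] at hv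
    have e1 : (v : ℂ) ^ ((β : ℂ) - 1) = ((v ^ (β - 1) : ℝ) : ℂ) := by
      rw [Complex.ofReal_cpow hv.1]; simp
    have e2 : (1 - (v : ℂ)) ^ (((1 - β : ℝ) : ℂ) - 1) = (((1 - v) ^ (-β) : ℝ) : ℂ) := by
      rw [Complex.ofReal_cpow (by linarith [hv.2])]
      congr 1 <;> push_cast <;> ring
    simp only [e1, e2]
    push_cast; ring
  rw [h2, intervalIntegral.integral_ofReal, Complex.ofReal_re]

/-- After `x = s + (t - s) v` the powers of `t - s` cancel. That the value does not depend on `s`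
and `t` is what makes Abel inversion work. -/
lemma integral_beta_kernel {β s t : ℝ} (hβ : β ∈ Ioo (0 : ℝ) 1) (hst : s < t) :
    ∫ x in s..t, (t - x) ^ (-β) * (x - s) ^ (β - 1) = Real.Gamma β * Real.Gamma (1 - β) := by
  have hc : 0 < t - s := sub_pos.2 hst
  have h := intervalIntegral.smul_integral_comp_mul_add (a := 0) (b := 1)
    (fun x => (t - x) ^ (-β) * (x - s) ^ (β - 1)) (t - s) s
  simp only [mul_zero, zero_add, mul_one, sub_add_cancel] at h
  rw [← h, ← integral_beta_kernel_zero_one hβ, ← intervalIntegral.integral_smul]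
  refine intervalIntegral.integral_congr fun v hv => ?_
  rw [uIcc_of_le zero_le_one] at hv
  have e1 : t - ((t - s) * v + s) = (t - s) * (1 - v) := by ring
  have e2 : (t - s) * v + s - s = (t - s) * v := by ring
  simp only [e1, e2, smul_eq_mul]
  rw [Real.mul_rpow hc.le (by linarith [hv.2]), Real.mul_rpow hc.le hv.1]
  have e3 : (t - s) * ((t - s) ^ (-β) * (t - s) ^ (β - 1)) = 1 := by
    rw [← Real.rpow_add hc, show -β + (β - 1) = -1 by ring, Real.rpow_neg_one,
      mul_inv_cancel₀ hc.ne']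
  linear_combination ((1 - v) ^ (-β) * v ^ (β - 1)) * e3

variable {V : Type*} [NormedAddCommGroup V] [NormedSpace ℝ V]

lemma intervalIntegrable_rlKernel {β : ℝ} (hβ : 0 < β) (t : ℝ) :
    IntervalIntegrable (fun x => (t - x) ^ (β - 1)) volume 0 t := by
  have h := (intervalIntegral.intervalIntegrable_rpow' (a := t) (b := 0)
    (r := β - 1) (by linarith)).comp_sub_left t
  simpa using h

lemma intervalIntegrable_rlKernel_smul {β : ℝ} (hβ : 0 < β) {t : ℝ} (ht : 0 ≤ t) {g : ℝ → V}
    (hg : ContinuousOn g (Icc 0 t)) :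
    IntervalIntegrable (fun x => (t - x) ^ (β - 1) • g x) volume 0 t :=
  (intervalIntegrable_rlKernel hβ t).smul_continuousOn (by rwa [uIcc_of_le ht])

lemma rlIntegral_congr {β t : ℝ} (ht : 0 ≤ t) {g h : ℝ → V} (hgh : EqOn g h (Icc 0 t)) :
    rlIntegral β g t = rlIntegral β h t := by
  unfold rlIntegral
  congr 1
  refine intervalIntegral.integral_congr fun x hx => ?_
  rw [uIcc_of_le ht] at hx
  simp only [hgh hx]

@[simp] lemma rlIntegral_at_zero (β : ℝ) (g : ℝ → V) : rlIntegral β g 0 = 0 := by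
  simp [rlIntegral]

lemma rlIntegral_sub {β : ℝ} (hβ : 0 < β) {t : ℝ} (ht : 0 ≤ t) {g h : ℝ → V}
    (hg : ContinuousOn g (Icc 0 t)) (hh : ContinuousOn h (Icc 0 t)) :
    rlIntegral β (fun x => g x - h x) t = rlIntegral β g t - rlIntegral β h t := by
  simp only [rlIntegral, smul_sub]
  rw [intervalIntegral.integral_sub (intervalIntegrable_rlKernel_smul hβ ht hg)
    (intervalIntegrable_rlKernel_smul hβ ht hh), smul_sub]

/-- Substituting `x = t v` fixes both the domain and the singularity, so that continuity in `t`
follows by dominated convergence. -/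
lemma rlIntegral_eq_scaled {β : ℝ} (hβ : 0 < β) {t : ℝ} (ht : 0 ≤ t) (g : ℝ → V) :
    rlIntegral β g t =
      (Real.Gamma β)⁻¹ • t ^ β • ∫ v in (0 : ℝ)..1, (1 - v) ^ (β - 1) • g (t * v) := by
  rcases ht.eq_or_lt with rfl | ht
  · simp [Real.zero_rpow hβ.ne']
  unfold rlIntegral
  have h := intervalIntegral.smul_integral_comp_mul_left (a := 0) (b := 1)
    (fun x => (t - x) ^ (β - 1) • g x) t
  simp only [mul_zero, mul_one] at h
  rw [← h, ← intervalIntegral.integral_smul t, ← intervalIntegral.integral_smul (t ^ β)]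
  congr 1
  refine intervalIntegral.integral_congr fun v hv => ?_
  rw [uIcc_of_le zero_le_one] at hv
  have e1 : t - t * v = t * (1 - v) := by ring
  simp only [e1, smul_smul]
  rw [Real.mul_rpow ht.le (by linarith [hv.2]), ← mul_assoc]
  congr 2
  rw [Real.rpow_sub_one ht.ne']; field_simp

/-- Extend `g` by its end values, to work with globally continuous bounded functions. -/
lemma exists_continuous_eqOn_Icc {W : Type*} [NormedAddCommGroup W] {T : ℝ} (hT : 0 ≤ T)
    {g : ℝ → W}
    (hg : ContinuousOn g (Icc 0 T)) :
    ∃ h : ℝ → W, Continuous h ∧ EqOn g h (Icc 0 T) ∧ ∃ M, ∀ x, ‖h x‖ ≤ M := by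
  refine ⟨IccExtend hT ((Icc 0 T).domRestrict g),
    (continuousOn_iff_continuous_domRestrict.1 hg).Icc_extend',
    fun x hx => by rw [IccExtend_of_mem hT _ hx]; rfl, ?_⟩
  obtain ⟨M, hM⟩ := isCompact_Icc.exists_bound_of_continuousOn hg
  exact ⟨M, fun x => hM _ (projIcc 0 T hT x).2⟩

lemma continuousOn_rlIntegral {β : ℝ} (hβ : 0 < β) {T : ℝ} (hT : 0 ≤ T) {g : ℝ → V}
    (hg : ContinuousOn g (Icc 0 T)) : ContinuousOn (rlIntegral β g) (Icc 0 T) := by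
  obtain ⟨h, hc, hgh, M, hM⟩ := exists_continuous_eqOn_Icc hT hg
  have key : Continuous fun t : ℝ => (Real.Gamma β)⁻¹ • t ^ β •
      ∫ v in (0 : ℝ)..1, (1 - v) ^ (β - 1) • h (t * v) := by
    refine ((Real.continuous_rpow_const hβ.le).smul ?_).const_smul _
    refine intervalIntegral.continuous_of_dominated_interval
      (bound := fun v => (1 - v) ^ (β - 1) * M) (fun t => ?_) (fun t => ?_) ?_ ?_
    · exact AEStronglyMeasurable.smul (by fun_prop : Measurable _).aestronglyMeasurable
        (by fun_prop : Continuous _).aestronglyMeasurable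
    · refine ae_of_all _ fun v hv => ?_
      rw [uIoc_of_le zero_le_one] at hv
      have : 0 ≤ (1 - v) ^ (β - 1) := Real.rpow_nonneg (by linarith [hv.2]) _
      rw [norm_smul, Real.norm_of_nonneg this]
      exact mul_le_mul_of_nonneg_left (hM _) this
    · exact (intervalIntegrable_rlKernel hβ 1).mul_const M
    · exact ae_of_all _ fun v _ => by fun_prop
  refine key.continuousOn.congr fun t ht => ?_
  rw [rlIntegral_congr ht.1 (hgh.mono (Icc_subset_Icc_right ht.2)), rlIntegral_eq_scaled hβ ht.1]

/-- Fubini on the triangle `0 < s < x < t`: with `s` fixed, the integral over `x` is the Beta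
integral, a constant. -/
lemma integral_rlKernel_rlKernel [CompleteSpace V] {β t : ℝ} (hβ : β ∈ Ioo (0 : ℝ) 1)
    (ht : 0 ≤ t) {h : ℝ → V} (hh : Continuous h) :
    ∫ x in (0 : ℝ)..t, (t - x) ^ (-β) • ∫ s in (0 : ℝ)..x, (x - s) ^ (β - 1) • h s =
      (Real.Gamma β * Real.Gamma (1 - β)) • ∫ s in (0 : ℝ)..t, h s := by
  set B := Real.Gamma β * Real.Gamma (1 - β)
  have hBpos : 0 < B := mul_pos (Real.Gamma_pos_of_pos hβ.1)
    (Real.Gamma_pos_of_pos (by linarith [hβ.2]))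
  set D : Set (ℝ × ℝ) := {p | 0 < p.2 ∧ p.2 < p.1 ∧ p.1 < t}
  have hDm : MeasurableSet D := by
    have : IsOpen D := (isOpen_lt continuous_const continuous_snd).inter
      ((isOpen_lt continuous_snd continuous_fst).inter (isOpen_lt continuous_fst continuous_const))
    exact this.measurableSet
  set k : ℝ × ℝ → ℝ := fun p => (t - p.1) ^ (-β) * (p.1 - p.2) ^ (β - 1)
  have hkm : Measurable k := by fun_prop
  have hknn : ∀ p ∈ D, 0 ≤ k p := fun p hp =>
    mul_nonneg (Real.rpow_nonneg (by linarith [hp.2.2]) _)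
      (Real.rpow_nonneg (by linarith [hp.2.1]) _)
  set F : ℝ × ℝ → V := D.indicator fun p => k p • h p.2 with hF
  have hFm : AEStronglyMeasurable F ((volume : Measure ℝ).prod volume) :=
    (hkm.aestronglyMeasurable.smul
      (hh.comp continuous_snd).aestronglyMeasurable).indicator hDm
  -- sections with fixed second coordinate
  have sec : ∀ s ∈ Ioo 0 t, (fun x => F (x, s)) = (Ioo s t).indicator fun x => k (x, s) • h s := by
    intro s hs
    ext x
    by_cases hx : x ∈ Ioo s t
    · rw [indicator_of_mem hx, hF, indicator_of_mem (show (x, s) ∈ D from ⟨hs.1, hx.1, hx.2⟩)]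
    · rw [indicator_of_notMem hx, hF, indicator_of_notMem (fun hd : (x, s) ∈ D => hx ⟨hd.2.1, hd.2.2⟩)]
  have sec0 : ∀ s, s ∉ Ioo 0 t → (fun x => F (x, s)) = 0 := by
    intro s hs
    ext x
    rw [hF, indicator_of_notMem (fun hd : (x, s) ∈ D => hs ⟨hd.1, hd.2.1.trans hd.2.2⟩)]; rfl
  have kint : ∀ s ∈ Ioo 0 t, ∫ x in Ioo s t, k (x, s) = B := by
    intro s hs
    rw [← integral_Ioc_eq_integral_Ioo, ← intervalIntegral.integral_of_le hs.2.le]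
    exact integral_beta_kernel hβ hs.2
  -- A nonintegrable function has Bochner integral `0`, so a nonzero value already proves
  -- integrability.
  have kintble : ∀ s ∈ Ioo 0 t, IntegrableOn (fun x => k (x, s)) (Ioo s t) := fun s hs =>
    .of_integral_ne_zero (by rw [kint s hs]; exact hBpos.ne')
  have hFint : Integrable F ((volume : Measure ℝ).prod volume) := by
    rw [integrable_prod_iff' hFm]
    constructor
    · refine ae_of_all _ fun s => ?_
      by_cases hs : s ∈ Ioo 0 t
      · rw [sec s hs, integrable_indicator_iff measurableSet_Ioo]
        exact (kintble s hs).smul_const _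
      · rw [sec0 s hs]; exact integrable_zero _ _ _
    · have : (fun s => ∫ x, ‖F (x, s)‖) = (Ioo 0 t).indicator fun s => B * ‖h s‖ := by
        ext s
        by_cases hs : s ∈ Ioo 0 t
        · rw [indicator_of_mem hs]
          have e : (fun x => ‖F (x, s)‖) = (Ioo s t).indicator fun x => k (x, s) * ‖h s‖ := by
            ext x
            rw [congrFun (sec s hs) x]
            by_cases hx : x ∈ Ioo s t
            · rw [indicator_of_mem hx, indicator_of_mem hx, norm_smul,
                Real.norm_of_nonneg (hknn (x, s) ⟨hs.1, hx.1, hx.2⟩)]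
            · rw [indicator_of_notMem hx, indicator_of_notMem hx, norm_zero]
          rw [e, integral_indicator measurableSet_Ioo, integral_mul_const, kint s hs]
        · rw [indicator_of_notMem hs]
          have e : (fun x => ‖F (x, s)‖) = fun _ => 0 := by
            ext x; rw [congrFun (sec0 s hs) x]; simp
          rw [e]; simp
      rw [this, integrable_indicator_iff measurableSet_Ioo]
      exact ((by fun_prop : Continuous fun s => B * ‖h s‖).integrableOn_Icc).mono_set
        Ioo_subset_Icc_self
  have swap := integral_integral_swap (f := fun x s => F (x, s)) hFint
  have lhs : (fun x => ∫ s, F (x, s)) = (Ioo 0 t).indicator fun x => (t - x) ^ (-β) •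
      ∫ s in (0 : ℝ)..x, (x - s) ^ (β - 1) • h s := by
    ext x
    by_cases hx : x ∈ Ioo 0 t
    · rw [indicator_of_mem hx, intervalIntegral.integral_of_le hx.1.le,
        integral_Ioc_eq_integral_Ioo, ← integral_smul, ← integral_indicator measurableSet_Ioo]
      congr 1
      ext s
      by_cases hs : s ∈ Ioo 0 x
      · rw [indicator_of_mem hs, hF, indicator_of_mem (show (x, s) ∈ D from ⟨hs.1, hs.2, hx.2⟩),
          smul_smul]
      · rw [indicator_of_notMem hs, hF,
          indicator_of_notMem (fun hd : (x, s) ∈ D => hs ⟨hd.1, hd.2.1⟩)]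
    · rw [indicator_of_notMem hx]
      have e : (fun s => F (x, s)) = fun _ => 0 := by
        ext s
        rw [hF, indicator_of_notMem (fun hd : (x, s) ∈ D => hx ⟨hd.1.trans hd.2.1, hd.2.2⟩)]
      rw [e]; simp
  have rhs : (fun s => ∫ x, F (x, s)) = (Ioo 0 t).indicator fun s => B • h s := by
    ext s
    by_cases hs : s ∈ Ioo 0 t
    · rw [indicator_of_mem hs, sec s hs, integral_indicator measurableSet_Ioo,
        integral_smul_const, kint s hs]
    · rw [indicator_of_notMem hs, sec0 s hs]; simp
  rw [lhs, rhs, integral_indicator measurableSet_Ioo, integral_indicator measurableSet_Ioo,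
    integral_smul, ← integral_Ioc_eq_integral_Ioo, ← integral_Ioc_eq_integral_Ioo,
    ← intervalIntegral.integral_of_le ht, ← intervalIntegral.integral_of_le ht] at swap
  exact swap

lemma rlIntegral_rlIntegral [CompleteSpace V] {β t : ℝ} (hβ : β ∈ Ioo (0 : ℝ) 1) (ht : 0 ≤ t)
    {g : ℝ → V} (hg : ContinuousOn g (Icc 0 t)) :
    rlIntegral (1 - β) (rlIntegral β g) t = ∫ s in (0 : ℝ)..t, g s := by
  obtain ⟨h, hc, hgh, -⟩ := exists_continuous_eqOn_Icc ht hg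
  have e : rlIntegral (1 - β) (rlIntegral β g) t = rlIntegral (1 - β) (rlIntegral β h) t :=
    rlIntegral_congr ht fun x hx => rlIntegral_congr hx.1 (hgh.mono (Icc_subset_Icc_right hx.2))
  have e2 : ∫ s in (0 : ℝ)..t, g s = ∫ s in (0 : ℝ)..t, h s :=
    intervalIntegral.integral_congr fun x hx => hgh (by rwa [uIcc_of_le ht] at hx)
  have hΓ := (Real.Gamma_pos_of_pos hβ.1).ne'
  have hΓ' := (Real.Gamma_pos_of_pos (show 0 < 1 - β by linarith [hβ.2])).ne'
  rw [e, e2]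
  unfold rlIntegral
  simp_rw [smul_comm _ (Real.Gamma β)⁻¹]
  rw [intervalIntegral.integral_smul, show 1 - β - 1 = -β by ring,
    integral_rlKernel_rlKernel hβ ht hc, smul_smul, smul_smul,
    show (Real.Gamma (1 - β))⁻¹ * (Real.Gamma β)⁻¹ * (Real.Gamma β * Real.Gamma (1 - β)) = 1 by
      field_simp, one_smul]

/-! ### Exponential weights and the fractional Gronwall inequality. -/

/-- With `u = t - x` the factor `e^(λt)` comes out; what remains is bounded by the Laplace transform
of `u^(β-1)` over the half-line. -/
lemma integral_rlKernel_exp_le {β lam t : ℝ} (hβ : 0 < β) (hl : 0 < lam) (ht : 0 ≤ t) :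
    ∫ x in (0 : ℝ)..t, (t - x) ^ (β - 1) * Real.exp (lam * x) ≤
      Real.Gamma β * lam ^ (-β) * Real.exp (lam * t) := by
  have key := Real.integral_rpow_mul_exp_neg_mul_Ioi hβ hl
  have hint : IntegrableOn (fun u : ℝ => u ^ (β - 1) * Real.exp (-(lam * u))) (Ioi 0) :=
    .of_integral_ne_zero (by rw [key]; have := Real.Gamma_pos_of_pos hβ; positivity)
  have h1 : ∫ x in (0 : ℝ)..t, (t - x) ^ (β - 1) * Real.exp (lam * x) =
      Real.exp (lam * t) * ∫ u in (0 : ℝ)..t, u ^ (β - 1) * Real.exp (-(lam * u)) := by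
    have h := intervalIntegral.integral_comp_sub_left (a := 0) (b := t)
      (fun u => u ^ (β - 1) * Real.exp (-(lam * u))) t
    rw [sub_self, sub_zero] at h
    rw [← h, ← intervalIntegral.integral_const_mul]
    congr 1
    ext x
    rw [mul_left_comm, ← Real.exp_add]
    congr 2; ring
  have h2 : ∫ u in (0 : ℝ)..t, u ^ (β - 1) * Real.exp (-(lam * u)) ≤
      (1 / lam) ^ β * Real.Gamma β := by
    rw [← key, intervalIntegral.integral_of_le ht]
    refine setIntegral_mono_set hint ?_ Ioc_subset_Ioi_self.eventuallyLE
    rw [EventuallyLE, ae_restrict_iff' measurableSet_Ioi]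
    exact ae_of_all _ fun u (hu : 0 < u) => by simp only [Pi.zero_apply]; positivity
  rw [h1, Real.rpow_neg hl.le, ← Real.inv_rpow hl.le, ← one_div]
  nlinarith [Real.exp_pos (lam * t)]

lemma norm_rlIntegral_le_exp {β lam t M : ℝ} (hβ : 0 < β) (hl : 0 < lam) (ht : 0 ≤ t)
    (hM : 0 ≤ M) {g : ℝ → V} (hg : ∀ x ∈ Icc 0 t, ‖g x‖ ≤ M * Real.exp (lam * x)) :
    ‖rlIntegral β g t‖ ≤ M * lam ^ (-β) * Real.exp (lam * t) := by
  have hΓ := Real.Gamma_pos_of_pos hβ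
  have h1 : ‖∫ x in (0 : ℝ)..t, (t - x) ^ (β - 1) • g x‖ ≤
      ∫ x in (0 : ℝ)..t, M * ((t - x) ^ (β - 1) * Real.exp (lam * x)) := by
    refine intervalIntegral.norm_integral_le_of_norm_le ht (ae_of_all _ fun x hx => ?_)
      (((intervalIntegrable_rlKernel hβ t).mul_continuousOn (by fun_prop)).const_mul M)
    have h0 : 0 ≤ (t - x) ^ (β - 1) := Real.rpow_nonneg (by linarith [hx.2]) _
    rw [norm_smul, Real.norm_of_nonneg h0]
    calc _ ≤ (t - x) ^ (β - 1) * (M * Real.exp (lam * x)) :=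
          mul_le_mul_of_nonneg_left (hg x ⟨hx.1.le, hx.2⟩) h0
      _ = _ := by ring
  rw [intervalIntegral.integral_const_mul] at h1
  rw [rlIntegral, norm_smul, Real.norm_of_nonneg (inv_nonneg.2 hΓ.le), inv_mul_le_iff₀ hΓ]
  calc _ ≤ _ := h1
    _ ≤ M * (Real.Gamma β * lam ^ (-β) * Real.exp (lam * t)) :=
      mul_le_mul_of_nonneg_left (integral_rlKernel_exp_le hβ hl ht) hM
    _ = _ := by ring

/-- An exponential rate `λ` with `(L + 1) λ^(-α) = 1/2`. -/
noncomputable def gronwallRate (α L : ℝ) : ℝ := (2 * (L + 1)) ^ (1 / α)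

/-- The constant of the fractional Gronwall inequality on `[0, T]`. -/
noncomputable def gronwallConst (α T L : ℝ) : ℝ := 2 * Real.exp (gronwallRate α L * T)

lemma gronwallRate_pos {α L : ℝ} (hL : 0 ≤ L) : 0 < gronwallRate α L :=
  Real.rpow_pos_of_pos (by linarith) _

lemma add_one_mul_gronwallRate_rpow {α L : ℝ} (hα : 0 < α) (hL : 0 ≤ L) :
    (L + 1) * gronwallRate α L ^ (-α) = 1 / 2 := by
  rw [gronwallRate, ← Real.rpow_mul (by linarith), show 1 / α * (-α) = -1 by field_simp,
    Real.rpow_neg_one]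
  field_simp

lemma two_le_gronwallConst {α T L : ℝ} (hT : 0 ≤ T) (hL : 0 ≤ L) : 2 ≤ gronwallConst α T L := by
  have := Real.one_le_exp (mul_nonneg (gronwallRate_pos (α := α) hL).le hT)
  unfold gronwallConst; linarith

lemma gronwallConst_mono {α T T' L : ℝ} (hL : 0 ≤ L) (hT : T' ≤ T) :
    gronwallConst α T' L ≤ gronwallConst α T L := by
  have := gronwallRate_pos (α := α) hL
  unfold gronwallConst; gcongr

/-- Evaluate the inequality where `e^(-λt) ‖w(t)‖` attains its maximum `M`. This gives `M ≤ a + (L M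
+ b) λ^(-α)`, and the choice of `λ` absorbs the `M` on the right. -/
lemma norm_le_of_norm_le_add_rlIntegral {W : Type*} [NormedAddCommGroup W] {α T L a b : ℝ}
    (hα : 0 < α) (hT : 0 ≤ T) (hL : 0 ≤ L) (ha : 0 ≤ a) (hb : 0 ≤ b) {w : ℝ → W} {g : ℝ → V}
    (hw : ContinuousOn w (Icc 0 T)) (hg : ∀ s ∈ Icc 0 T, ‖g s‖ ≤ L * ‖w s‖ + b)
    (h : ∀ t ∈ Icc 0 T, ‖w t‖ ≤ a + ‖rlIntegral α g t‖) :
    ∀ t ∈ Icc 0 T, ‖w t‖ ≤ gronwallConst α T L * (a + b) := by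
  set lam := gronwallRate α L
  have hl : 0 < lam := gronwallRate_pos hL
  have hlr := add_one_mul_gronwallRate_rpow hα hL
  have hr : 0 ≤ lam ^ (-α) := Real.rpow_nonneg hl.le _
  obtain ⟨t₀, ht₀, hmax⟩ := isCompact_Icc.exists_isMaxOn (nonempty_Icc.2 hT)
    (f := fun t => Real.exp (-(lam * t)) * ‖w t‖) (by fun_prop)
  set M := Real.exp (-(lam * t₀)) * ‖w t₀‖ with hM
  have hM0 : 0 ≤ M := by positivity
  have hwM : ∀ t ∈ Icc 0 T, ‖w t‖ ≤ M * Real.exp (lam * t) := by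
    intro t ht
    have := hmax ht
    change Real.exp (-(lam * t)) * ‖w t‖ ≤ M at this
    rw [Real.exp_neg, inv_mul_le_iff₀ (Real.exp_pos _)] at this
    linarith
  have h1 : ∀ t, 0 ≤ t → 1 ≤ Real.exp (lam * t) := fun t ht =>
    Real.one_le_exp (mul_nonneg hl.le ht)
  have hb2 := norm_rlIntegral_le_exp hα hl ht₀.1 (M := L * M + b) (by positivity) (g := g)
    fun x hx => by
      have hxT : x ∈ Icc 0 T := ⟨hx.1, hx.2.trans ht₀.2⟩
      calc _ ≤ L * ‖w x‖ + b := hg x hxT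
        _ ≤ L * (M * Real.exp (lam * x)) + b * Real.exp (lam * x) :=
          add_le_add (mul_le_mul_of_nonneg_left (hwM x hxT) hL)
            (le_mul_of_one_le_right hb (h1 x hx.1))
        _ = _ := by ring
  have hM2 : M ≤ a + (L * M + b) * lam ^ (-α) := by
    refine le_of_mul_le_mul_left ?_ (Real.exp_pos (lam * t₀))
    have hMe : Real.exp (lam * t₀) * M = ‖w t₀‖ := by
      rw [hM, ← mul_assoc, ← Real.exp_add]; simp
    have := h t₀ ht₀
    have := le_mul_of_one_le_right ha (h1 t₀ ht₀.1)
    linarith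
  -- The `L + 1` in the rate bounds both `L λ^(-α)` and `λ^(-α)`, and allows `L = 0`.
  have hL' : L * lam ^ (-α) ≤ 1 / 2 := by linarith
  have hone : lam ^ (-α) ≤ 1 := by nlinarith
  have hM3 : M ≤ 2 * (a + b) := by nlinarith
  intro t ht
  calc ‖w t‖ ≤ M * Real.exp (lam * t) := hwM t ht
    _ ≤ 2 * (a + b) * Real.exp (lam * T) :=
      mul_le_mul hM3 (Real.exp_le_exp.2 (mul_le_mul_of_nonneg_left ht.2 hl.le))
        (Real.exp_pos _).le (by positivity)
    _ = _ := by unfold gronwallConst; ring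

end RiemannLiouville

/-! ### Equivalence with the Volterra equation. -/

section Volterra

open MeasureTheory

variable {V : Type*} [NormedAddCommGroup V] [NormedSpace ℝ V] {α T : ℝ} {F : ℝ → V → V} {y₀ : V}
  {z : ℝ → V}

lemma IsCaputoSolution.mono (hz : IsCaputoSolution α T F y₀ z) {T' : ℝ} (hT : T' ≤ T) :
    IsCaputoSolution α T' F y₀ z where
  continuousOn := hz.continuousOn.mono (Icc_subset_Icc_right hT)
  initial := hz.initial
  equation t ht := (hz.equation t ⟨ht.1, ht.2.trans hT⟩).mono (Icc_subset_Icc_right hT)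

lemma hasDerivWithinAt_integral_of_continuousOn [CompleteSpace V] (hT : 0 ≤ T) {g : ℝ → V}
    (hg : ContinuousOn g (Icc 0 T)) {t : ℝ} (ht : t ∈ Icc 0 T) :
    HasDerivWithinAt (fun u => ∫ s in (0 : ℝ)..u, g s) (g t) (Icc 0 T) t := by
  obtain ⟨h, hc, hgh, -⟩ := exists_continuous_eqOn_Icc hT hg
  have key : ∀ u ∈ Icc 0 T, ∫ s in (0 : ℝ)..u, g s = ∫ s in (0 : ℝ)..u, h s := fun u hu =>
    intervalIntegral.integral_congr fun x hx => by
      rw [uIcc_of_le hu.1] at hx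
      exact hgh ⟨hx.1, hx.2.trans hu.2⟩
  rw [hgh ht]
  exact (hc.integral_hasStrictDerivAt 0 t).hasDerivAt.hasDerivWithinAt.congr key (key t ht)

lemma eqOn_zero_of_integral_eq_zero [CompleteSpace V] (hT : 0 < T) {g : ℝ → V}
    (hg : ContinuousOn g (Icc 0 T)) (h : ∀ t ∈ Icc 0 T, ∫ s in (0 : ℝ)..t, g s = 0) {t : ℝ}
    (ht : t ∈ Icc 0 T) : g t = 0 :=
  (uniqueDiffOn_Icc hT t ht).eq_deriv _
    (hasDerivWithinAt_integral_of_continuousOn hT.le hg ht)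
    ((hasDerivWithinAt_const t (Icc 0 T) (0 : V)).congr h (h t ht))

/-- Integrating the equation shows that `I^(1-α)` annihilates `d = z - z(0) - I^α g`. Applying `I^α`
gives `∫₀ᵘ d = 0` for every `u`, hence `d = 0`. -/
lemma IsCaputoSolution.eq_add_rlIntegral [CompleteSpace V] (hα : α ∈ Ioo (0 : ℝ) 1)
    (hz : IsCaputoSolution α T F y₀ z) (hF : ContinuousOn (fun s => F s (z s)) (Icc 0 T))
    {t : ℝ} (ht : t ∈ Icc 0 T) : z t = y₀ + rlIntegral α (fun s => F s (z s)) t := by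
  -- On a one-point interval derivatives are not unique, so `T = 0` is treated apart.
  rcases (ht.1.trans ht.2).eq_or_lt with rfl | hT
  · obtain rfl : t = 0 := le_antisymm ht.2 ht.1
    simp [hz.initial]
  have hα' : 1 - α ∈ Ioo (0 : ℝ) 1 := ⟨by linarith [hα.2], by linarith [hα.1]⟩
  set g := fun s => F s (z s)
  have hw : ContinuousOn (fun x => z x - z 0) (Icc 0 T) := hz.continuousOn.sub continuousOn_const
  have hI : ContinuousOn (rlIntegral α g) (Icc 0 T) := continuousOn_rlIntegral hα.1 hT.le hF
  have sub : ∀ {u}, u ∈ Icc 0 T → Icc 0 u ⊆ Icc 0 T := fun hu => Icc_subset_Icc_right hu.2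
  have ftc : ∀ u ∈ Icc 0 T,
      rlIntegral (1 - α) (fun x => z x - z 0) u = ∫ s in (0 : ℝ)..u, g s := by
    intro u hu
    have := intervalIntegral.integral_eq_sub_of_hasDeriv_right_of_le (a := 0) (b := u) (f' := g)
      (f := rlIntegral (1 - α) fun x => z x - z 0) hu.1
      ((continuousOn_rlIntegral hα'.1 hT.le hw).mono (sub hu))
      (fun x hx => ((hz.equation x ⟨hx.1.le, hx.2.le.trans hu.2⟩).hasDerivAt
        (Icc_mem_nhds hx.1 (hx.2.trans_le hu.2))).hasDerivWithinAt)
      ((hF.mono (sub hu)).intervalIntegrable_of_Icc hu.1)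
    rw [this, rlIntegral_at_zero, sub_zero]
  have hd0 : EqOn (rlIntegral (1 - α) fun x => (z x - z 0) - rlIntegral α g x) (fun _ => 0)
      (Icc 0 T) := fun u hu => by
    rw [rlIntegral_sub hα'.1 hu.1 (hw.mono (sub hu)) (hI.mono (sub hu)), ftc u hu,
      rlIntegral_rlIntegral hα hu.1 (hF.mono (sub hu)), sub_self]
  have hint : ∀ u ∈ Icc 0 T, ∫ s in (0 : ℝ)..u, ((z s - z 0) - rlIntegral α g s) = 0 := by
    intro u hu
    -- Abel inversion with `β = 1 - α`: the outer operator is now `I^α`.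
    have := rlIntegral_rlIntegral (g := fun x => (z x - z 0) - rlIntegral α g x) hα' hu.1
      ((hw.sub hI).mono (sub hu))
    rw [← this, sub_sub_cancel, rlIntegral_congr hu.1 (hd0.mono (sub hu))]
    simp [rlIntegral]
  have := eqOn_zero_of_integral_eq_zero hT (hw.sub hI) hint ht
  rw [Pi.sub_apply, hz.initial, sub_sub, sub_eq_zero] at this
  exact this

lemma isCaputoSolution_of_eq_add_rlIntegral [CompleteSpace V] (hα : α ∈ Ioo (0 : ℝ) 1)
    (hT : 0 ≤ T) (hc : ContinuousOn z (Icc 0 T))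
    (hF : ContinuousOn (fun s => F s (z s)) (Icc 0 T))
    (h : ∀ t ∈ Icc 0 T, z t = y₀ + rlIntegral α (fun s => F s (z s)) t) :
    IsCaputoSolution α T F y₀ z where
  continuousOn := hc
  initial := by simpa using h 0 ⟨le_rfl, hT⟩
  equation t ht := by
    have h0 : z 0 = y₀ := by simpa using h 0 ⟨le_rfl, hT⟩
    have key : ∀ u ∈ Icc 0 T, rlIntegral (1 - α) (fun x => z x - z 0) u =
        ∫ s in (0 : ℝ)..u, F s (z s) := by
      intro u hu
      rw [← rlIntegral_rlIntegral hα hu.1 (hF.mono (Icc_subset_Icc_right hu.2))]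
      refine rlIntegral_congr hu.1 fun x hx => ?_
      simp only [h x ⟨hx.1, hx.2.trans hu.2⟩, h0, add_sub_cancel_left]
    exact (hasDerivWithinAt_integral_of_continuousOn hT hF ht).congr key (key t ht)

end Volterra

/-! ### Existence, uniqueness and Lipschitz dependence near a known solution. -/

section Stability

variable {V : Type*} [NormedAddCommGroup V] {α T r L : ℝ} {F : ℝ → V → V}
  {c z z' : ℝ → V} {ρ ρ' : V}

/-- The closed tube of radius `r` around the graph of `c` over `[0, T]`. -/
def closedTube (T r : ℝ) (c : ℝ → V) : Set (ℝ × V) :=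
  {p | p.1 ∈ Icc 0 T ∧ ‖p.2 - c p.1‖ ≤ r}

/-- In the closed tube of radius `r` around the curve `c` over `[0, T]`, the function `F(t, x)` is
continuous, and `L`-Lipschitz with respect to `x`. -/
structure IsLipschitzOnTube (T r L : ℝ) (F : ℝ → V → V) (c : ℝ → V) : Prop where
  continuousOn : ContinuousOn (fun p : ℝ × V => F p.1 p.2) (closedTube T r c)
  norm_sub_le : ∀ t ∈ Icc 0 T, ∀ x y, ‖x - c t‖ ≤ r → ‖y - c t‖ ≤ r →
    ‖F t x - F t y‖ ≤ L * ‖x - y‖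

lemma IsLipschitzOnTube.mono (h : IsLipschitzOnTube T r L F c) {T' : ℝ} (hT : T' ≤ T) :
    IsLipschitzOnTube T' r L F c where
  continuousOn := h.continuousOn.mono fun _ hp => ⟨⟨hp.1.1, hp.1.2.trans hT⟩, hp.2⟩
  norm_sub_le t ht := h.norm_sub_le t ⟨ht.1, ht.2.trans hT⟩

lemma IsLipschitzOnTube.continuousOn_comp (h : IsLipschitzOnTube T r L F c)
    (hz : ContinuousOn z (Icc 0 T)) (hr : ∀ t ∈ Icc 0 T, ‖z t - c t‖ ≤ r) :
    ContinuousOn (fun t => F t (z t)) (Icc 0 T) :=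
  h.continuousOn.comp (f := fun t => (t, z t)) (continuousOn_id.prodMk hz)
    fun t ht => ⟨ht, hr t ht⟩

variable [NormedSpace ℝ V]

lemma HasUniqueCaputoSolution.isCaputoSolution (h : HasUniqueCaputoSolution α T F ρ) :
    IsCaputoSolution α T F ρ (caputoSolution α T F ρ) := by
  have hex : ∃ y, IsCaputoSolution α T F ρ y := ⟨h.choose, h.choose_spec.1⟩
  rw [caputoSolution, dif_pos hex]
  exact hex.choose_spec

lemma HasUniqueCaputoSolution.eqOn (h : HasUniqueCaputoSolution α T F ρ)
    (hz : IsCaputoSolution α T F ρ z) : EqOn (caputoSolution α T F ρ) z (Icc 0 T) := by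
  have hs := h.isCaputoSolution
  obtain ⟨y, -, hy⟩ := h
  exact (hy _ hs).trans (hy z hz).symm

variable [CompleteSpace V]

lemma IsLipschitzOnTube.norm_sub_le_of_mem (h : IsLipschitzOnTube T r L F c)
    (hα : α ∈ Ioo (0 : ℝ) 1) (hT : 0 ≤ T) (hL : 0 ≤ L)
    (hz : IsCaputoSolution α T F ρ z) (hz' : IsCaputoSolution α T F ρ' z')
    (hr : ∀ t ∈ Icc 0 T, ‖z t - c t‖ ≤ r) (hr' : ∀ t ∈ Icc 0 T, ‖z' t - c t‖ ≤ r) :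
    ∀ t ∈ Icc 0 T, ‖z t - z' t‖ ≤ gronwallConst α T L * ‖ρ - ρ'‖ := by
  have hF := h.continuousOn_comp hz.continuousOn hr
  have hF' := h.continuousOn_comp hz'.continuousOn hr'
  have := norm_le_of_norm_le_add_rlIntegral (w := fun t => z t - z' t) (b := 0)
    (g := fun s => F s (z s) - F s (z' s)) hα.1 hT hL (norm_nonneg (ρ - ρ')) le_rfl
    (hz.continuousOn.sub hz'.continuousOn)
    (fun s hs => by simpa using h.norm_sub_le s hs _ _ (hr s hs) (hr' s hs))
    (fun t ht => by
      have sub : Icc 0 t ⊆ Icc 0 T := Icc_subset_Icc_right ht.2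
      rw [rlIntegral_sub hα.1 ht.1 (hF.mono sub) (hF'.mono sub), hz.eq_add_rlIntegral hα hF ht,
        hz'.eq_add_rlIntegral hα hF' ht, add_sub_add_comm]
      exact norm_add_le _ _)
  simpa using this

/-- Solutions that start close to `c`, which is itself a solution, do not leave the tube. -/
lemma IsLipschitzOnTube.norm_sub_le_of_initial (h : IsLipschitzOnTube T r L F c)
    (hα : α ∈ Ioo (0 : ℝ) 1) (hT : 0 ≤ T) (hL : 0 ≤ L)
    (hc : IsCaputoSolution α T F ρ' c) (hz : IsCaputoSolution α T F ρ z)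
    (hρ : gronwallConst α T L * ‖ρ - ρ'‖ < r) :
    ∀ t ∈ Icc 0 T, ‖z t - c t‖ ≤ gronwallConst α T L * ‖ρ - ρ'‖ := by
  have hr0 : 0 ≤ r := le_trans (mul_nonneg (by linarith [two_le_gronwallConst (α := α) hT hL])
    (norm_nonneg _)) hρ.le
  have hcont : ContinuousOn (fun t => ‖z t - c t‖) (Icc 0 T) :=
    (hz.continuousOn.sub hc.continuousOn).norm
  -- Gronwall on `[0, t]` only needs the solution to be in the tube up to time `t`.
  have step : ∀ t ∈ Icc 0 T, (∀ s ∈ Icc 0 t, ‖z s - c s‖ ≤ r) →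
      ‖z t - c t‖ ≤ gronwallConst α T L * ‖ρ - ρ'‖ := fun t ht hs =>
    ((h.mono ht.2).norm_sub_le_of_mem hα ht.1 hL (hz.mono ht.2) (hc.mono ht.2) hs
      (fun s _ => by simpa using hr0) t ⟨ht.1, le_rfl⟩).trans
      (mul_le_mul_of_nonneg_right (gronwallConst_mono hL ht.2) (norm_nonneg _))
  suffices hall : ∀ t ∈ Icc 0 T, ‖z t - c t‖ < r from fun t ht =>
    step t ht fun s hs => (hall s ⟨hs.1, hs.2.trans ht.2⟩).le
  by_contra! hcon
  obtain ⟨t, ht, hrt⟩ := hcon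
  have hcl : IsCompact (Icc 0 T ∩ (fun t => ‖z t - c t‖) ⁻¹' Ici r) :=
    isCompact_Icc.of_isClosed_subset (hcont.preimage_isClosed_of_isClosed isClosed_Icc isClosed_Ici)
      inter_subset_left
  -- `t₁` is the first time at distance at least `r`. Before it the Gronwall bound holds, and it
  -- extends to `t₁` by continuity; being strictly below `r`, it gives a contradiction.
  obtain ⟨t₁, ⟨ht₁, hr₁⟩, hleast⟩ := hcl.exists_isLeast ⟨t, ht, hrt⟩
  have hlt : ∀ s ∈ Ico 0 t₁, ‖z s - c s‖ < r := fun s hs => by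
    by_contra! hge
    exact absurd (hleast ⟨⟨hs.1, hs.2.le.trans ht₁.2⟩, hge⟩) hs.2.not_ge
  have hbd : ∀ s ∈ Ico 0 t₁, ‖z s - c s‖ ≤ gronwallConst α T L * ‖ρ - ρ'‖ := fun s hs =>
    step s ⟨hs.1, hs.2.le.trans ht₁.2⟩ fun u hu => (hlt u ⟨hu.1, hu.2.trans_lt hs.2⟩).le
  have hfin : ‖z t₁ - c t₁‖ ≤ gronwallConst α T L * ‖ρ - ρ'‖ := by
    rcases ht₁.1.eq_or_lt with h0 | h0
    · rw [← h0, hz.initial, hc.initial]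
      nlinarith [two_le_gronwallConst (α := α) hT hL, norm_nonneg (ρ - ρ')]
    · have hmem : t₁ ∈ closure (Ico 0 t₁) := by
        rw [closure_Ico h0.ne]; exact ⟨h0.le, le_rfl⟩
      exact ((hcont t₁ ht₁).mono (Ico_subset_Icc_self.trans (Icc_subset_Icc_right ht₁.2))).closure_le
        hmem continuousWithinAt_const hbd
  exact absurd (hr₁ : r ≤ _) (hfin.trans_lt hρ).not_ge

/-- Banach's fixed point theorem for the scaled deviation `u(t) = e^(-λt) (z(t) - c(t))`. The
scaling turns the weighted norm into the usual sup norm of `C([0, T], V)`. -/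
lemma IsLipschitzOnTube.exists_isCaputoSolution (h : IsLipschitzOnTube T r L F c)
    (hα : α ∈ Ioo (0 : ℝ) 1) (hT : 0 ≤ T) (hL : 0 ≤ L) (hc : IsCaputoSolution α T F ρ' c)
    (hρ : gronwallConst α T L * ‖ρ - ρ'‖ ≤ r) :
    ∃ z, IsCaputoSolution α T F ρ z := by
  set lam := gronwallRate α L
  have hl : 0 < lam := gronwallRate_pos hL
  have hlr : (L + 1) * lam ^ (-α) = 1 / 2 := add_one_mul_gronwallRate_rpow hα.1 hL
  have hr : 0 ≤ lam ^ (-α) := Real.rpow_nonneg hl.le _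
  have hLl : L * lam ^ (-α) ≤ 1 / 2 := by linarith
  -- The self-map bound is `‖ρ - ρ'‖ + ε/2 = ε`, and `e^(λT) ε` is the Gronwall bound, which keeps
  -- the curves in the tube.
  set ε := 2 * ‖ρ - ρ'‖ with hε
  have hε0 : 0 ≤ ε := by positivity
  have hεr : Real.exp (lam * T) * ε ≤ r := by
    refine le_trans (le_of_eq ?_) hρ
    rw [gronwallConst, hε]; ring
  have hr0 : 0 ≤ r := le_trans (by positivity) hεr
  -- the curve with scaled deviation `u` from `c`
  let Z : C(Icc (0 : ℝ) T, V) → ℝ → V := fun u s =>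
    c s + Real.exp (lam * s) • u (projIcc 0 T hT s)
  have hZ_cont : ∀ u, ContinuousOn (Z u) (Icc 0 T) := fun u =>
    hc.continuousOn.add (Continuous.continuousOn (by fun_prop))
  have hnorm_exp : ∀ s (v : V), ‖Real.exp (lam * s) • v‖ = Real.exp (lam * s) * ‖v‖ := fun s v => by
    rw [norm_smul, Real.norm_of_nonneg (Real.exp_pos _).le]
  let S : Set C(Icc (0 : ℝ) T, V) := Metric.closedBall 0 ε
  have hS : ∀ u ∈ S, ∀ t, ‖u t‖ ≤ ε := fun u hu t =>
    (u.norm_coe_le_norm t).trans (by simpa [S] using hu)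
  have hZr : ∀ u ∈ S, ∀ s ∈ Icc 0 T, ‖Z u s - c s‖ ≤ r := fun u hu s hs => by
    rw [add_sub_cancel_left, hnorm_exp]
    exact (mul_le_mul (Real.exp_le_exp.2 (mul_le_mul_of_nonneg_left hs.2 hl.le)) (hS u hu _)
      (norm_nonneg _) (Real.exp_pos _).le).trans hεr
  have hFZ : ∀ u ∈ S, ContinuousOn (fun s => F s (Z u s)) (Icc 0 T) := fun u hu =>
    h.continuousOn_comp (hZ_cont u) (hZr u hu)
  have hFc : ContinuousOn (fun s => F s (c s)) (Icc 0 T) :=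
    h.continuousOn_comp hc.continuousOn fun s _ => by simpa using hr0
  -- weighted bound for the difference of two Volterra integrals
  have hdiff : ∀ y y' : ℝ → V, ∀ D, 0 ≤ D → ContinuousOn (fun s => F s (y s)) (Icc 0 T) →
      ContinuousOn (fun s => F s (y' s)) (Icc 0 T) → (∀ s ∈ Icc 0 T, ‖y s - c s‖ ≤ r) →
      (∀ s ∈ Icc 0 T, ‖y' s - c s‖ ≤ r) →
      (∀ s ∈ Icc 0 T, ‖y s - y' s‖ ≤ D * Real.exp (lam * s)) → ∀ t ∈ Icc 0 T,
      ‖rlIntegral α (fun s => F s (y s)) t - rlIntegral α (fun s => F s (y' s)) t‖ ≤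
        D / 2 * Real.exp (lam * t) := by
    intro y y' D hD hy hy' hyr hyr' hyy t ht
    have sub : Icc 0 t ⊆ Icc 0 T := Icc_subset_Icc_right ht.2
    rw [← rlIntegral_sub hα.1 ht.1 (hy.mono sub) (hy'.mono sub)]
    refine (norm_rlIntegral_le_exp hα.1 hl ht.1 (M := L * D) (by positivity)
      fun s hs => ?_).trans ?_
    · rw [mul_assoc]
      exact (h.norm_sub_le s (sub hs) _ _ (hyr s (sub hs)) (hyr' s (sub hs))).trans
        (mul_le_mul_of_nonneg_left (hyy s (sub hs)) hL)
    · refine mul_le_mul_of_nonneg_right ?_ (Real.exp_pos _).le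
      nlinarith
  have hG : ∀ u : S, ∃ v : S, ∀ t : Icc (0 : ℝ) T, (v : C(Icc (0 : ℝ) T, V)) t =
      Real.exp (-(lam * t)) • (ρ + rlIntegral α (fun s => F s (Z u s)) t - c t) := by
    rintro ⟨u, hu⟩
    have hcont : ContinuousOn (fun t : ℝ => Real.exp (-(lam * t)) •
        (ρ + rlIntegral α (fun s => F s (Z u s)) t - c t)) (Icc 0 T) :=
      ContinuousOn.smul (by fun_prop) ((continuousOn_const.add
        (continuousOn_rlIntegral hα.1 hT (hFZ u hu))).sub hc.continuousOn)
    refine ⟨⟨⟨_, continuousOn_iff_continuous_domRestrict.1 hcont⟩, ?_⟩, fun t => rfl⟩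
    rw [mem_closedBall_zero_iff, ContinuousMap.norm_le _ hε0]
    rintro ⟨t, ht⟩
    change ‖Real.exp (-(lam * t)) • (ρ + rlIntegral α (fun s => F s (Z u s)) t - c t)‖ ≤ ε
    rw [norm_smul, Real.norm_of_nonneg (Real.exp_pos _).le, Real.exp_neg,
      -- Writing `c` as its own Volterra integral leaves `ρ - ρ'` plus a difference of two
      -- integrals.
      inv_mul_le_iff₀ (Real.exp_pos _), hc.eq_add_rlIntegral hα hFc ht, add_sub_add_comm]
    have h1 := hdiff (Z u) c ε hε0 (hFZ u hu) hFc (hZr u hu) (fun s _ => by simpa using hr0)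
      (fun s hs => by
        rw [add_sub_cancel_left, hnorm_exp, mul_comm]
        exact mul_le_mul_of_nonneg_right (hS u hu _) (Real.exp_pos _).le) t ht
    have h2 : 1 ≤ Real.exp (lam * t) := Real.one_le_exp (mul_nonneg hl.le ht.1)
    calc _ ≤ _ := norm_add_le _ _
      _ ≤ ε / 2 * Real.exp (lam * t) + ε / 2 * Real.exp (lam * t) :=
        add_le_add (by nlinarith [norm_nonneg (ρ - ρ')]) h1
      _ = _ := by ring
  choose G hGeq using hG
  have hcontr : ContractingWith (1 / 2) G := by
    refine ⟨by norm_num, LipschitzWith.of_dist_le_mul fun u v => ?_⟩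
    rw [Subtype.dist_eq, Subtype.dist_eq, ContinuousMap.dist_le (by positivity)]
    rintro ⟨t, ht⟩
    rw [dist_eq_norm, hGeq, hGeq, ← smul_sub, norm_smul, Real.norm_of_nonneg (Real.exp_pos _).le,
      Real.exp_neg, inv_mul_le_iff₀ (Real.exp_pos _), sub_sub_sub_cancel_right,
      add_sub_add_left_eq_sub]
    refine (hdiff (Z u) (Z v) (dist (u : C(Icc (0 : ℝ) T, V)) v) dist_nonneg (hFZ u u.2) (hFZ v v.2)
      (hZr u u.2) (hZr v v.2) (fun s hs => ?_) t ht).trans (le_of_eq ?_)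
    · rw [add_sub_add_left_eq_sub, ← smul_sub, hnorm_exp, mul_comm, ← dist_eq_norm]
      exact mul_le_mul_of_nonneg_right (ContinuousMap.dist_apply_le_dist _) (Real.exp_pos _).le
    · push_cast; ring
  have : CompleteSpace S := Metric.isClosed_closedBall.completeSpace_coe
  have : Nonempty S := ⟨⟨0, Metric.mem_closedBall_self hε0⟩⟩
  set u := hcontr.fixedPoint G
  have hu : G u = u := hcontr.fixedPoint_isFixedPt
  refine ⟨Z u, isCaputoSolution_of_eq_add_rlIntegral hα hT (hZ_cont u) (hFZ u u.2) fun t ht => ?_⟩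
  have h1 := hGeq u ⟨t, ht⟩
  rw [hu] at h1
  change c t + Real.exp (lam * t) • u.1 (projIcc 0 T hT t) = _
  rw [projIcc_of_mem hT ht, h1, smul_smul, ← Real.exp_add]
  simp

/-- The a priori bound puts every competing solution inside the tube, so uniqueness holds among all
solutions. -/
lemma IsLipschitzOnTube.hasUniqueCaputoSolution (h : IsLipschitzOnTube T r L F c)
    (hα : α ∈ Ioo (0 : ℝ) 1) (hT : 0 ≤ T) (hL : 0 ≤ L) (hc : IsCaputoSolution α T F ρ' c)
    (hρ : gronwallConst α T L * ‖ρ - ρ'‖ < r) :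
    HasUniqueCaputoSolution α T F ρ := by
  obtain ⟨z, hz⟩ := h.exists_isCaputoSolution hα hT hL hc hρ.le
  refine ⟨z, hz, fun z' hz' t ht => ?_⟩
  have hb : ∀ {y}, IsCaputoSolution α T F ρ y → ∀ t ∈ Icc 0 T, ‖y t - c t‖ ≤ r :=
    fun hy t ht => (h.norm_sub_le_of_initial hα hT hL hc hy hρ t ht).trans hρ.le
  have := h.norm_sub_le_of_mem hα hT hL hz' hz (hb hz') (hb hz) t ht
  rwa [sub_self, norm_zero, mul_zero, norm_le_zero_iff, sub_eq_zero] at this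

end Stability

/-! ### Linear equations with continuous coefficients. -/

section Linear

variable {E : Type*} [NormedAddCommGroup E] [NormedSpace ℝ E] [CompleteSpace E] {α T : ℝ}

/-- A linear field is Lipschitz on tubes of any radius around the zero solution, so the radius can
be chosen large enough for the given `X₀`. -/
lemma hasUniqueCaputoSolution_comp (hα : α ∈ Ioo (0 : ℝ) 1) (hT : 0 ≤ T) {A : ℝ → E →L[ℝ] E}
    (hA : ContinuousOn A (Icc 0 T)) (X₀ : E →L[ℝ] E) :
    HasUniqueCaputoSolution α T (fun t X => (A t).comp X) X₀ := by
  obtain ⟨L, hL⟩ := isCompact_Icc.exists_bound_of_continuousOn hA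
  have hL0 : 0 ≤ L := (norm_nonneg _).trans (hL 0 ⟨le_rfl, hT⟩)
  have htube : IsLipschitzOnTube T (gronwallConst α T L * ‖X₀‖ + 1) L
      (fun t (X : E →L[ℝ] E) => (A t).comp X) (fun _ => 0) := by
    refine ⟨?_, fun t ht x y _ _ => ?_⟩
    · exact ((hA.comp continuousOn_fst fun p hp => hp.1).clm_comp continuousOn_snd)
    · rw [← ContinuousLinearMap.comp_sub]
      exact (ContinuousLinearMap.opNorm_comp_le _ _).trans
        (mul_le_mul_of_nonneg_right (hL t ht) (norm_nonneg _))
  refine htube.hasUniqueCaputoSolution hα hT hL0 (ρ' := 0)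
    (isCaputoSolution_of_eq_add_rlIntegral hα hT continuousOn_const ?_ fun t _ => ?_) (by simp)
  · simpa using continuousOn_const
  · simp [rlIntegral]

end Linear

/-! ### Compact tubes and uniform estimates for the right-hand side. -/

section Tube

variable {E : Type*} [NormedAddCommGroup E] {T : ℝ} {y : ℝ → E}

lemma isCompact_closedTube [ProperSpace E] (hy : ContinuousOn y (Icc 0 T)) (r : ℝ) :
    IsCompact (closedTube T r y) := by
  have himg : closedTube T r y =
      (fun p : ℝ × E => (p.1, y p.1 + p.2)) '' (Icc 0 T ×ˢ Metric.closedBall 0 r) := by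
    ext ⟨t, x⟩
    constructor
    · rintro ⟨ht, hx⟩
      exact ⟨(t, x - y t), ⟨ht, by simpa using hx⟩, by simp⟩
    · rintro ⟨⟨s, v⟩, ⟨hs, hv⟩, h⟩
      obtain ⟨rfl, rfl⟩ := Prod.ext_iff.1 h
      exact ⟨hs, by simpa using hv⟩
  rw [himg]
  exact (isCompact_Icc.prod (isCompact_closedBall 0 r)).image_of_continuousOn
    (continuousOn_fst.prodMk ((hy.comp continuousOn_fst fun p hp => hp.1).add continuousOn_snd))

lemma exists_closedTube_subset (hy : ContinuousOn y (Icc 0 T)) {U : Set (ℝ × E)} (hU : IsOpen U)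
    (hyU : ∀ t ∈ Icc 0 T, (t, y t) ∈ U) : ∃ r > 0, closedTube T r y ⊆ U := by
  have hK : IsCompact ((fun t => (t, y t)) '' Icc 0 T) :=
    isCompact_Icc.image_of_continuousOn (continuousOn_id.prodMk hy)
  obtain ⟨r, hr, hsub⟩ := hK.exists_cthickening_subset_open hU (image_subset_iff.2 hyU)
  refine ⟨r, hr, fun p hp => hsub ?_⟩
  refine Metric.mem_cthickening_of_dist_le p (p.1, y p.1) r _ (mem_image_of_mem _ hp.1) ?_
  rw [Prod.dist_eq, dist_self, dist_eq_norm]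
  exact max_le hr.le hp.2

variable [NormedSpace ℝ E] {r : ℝ} {f : ℝ → E → E}

/-- The Jacobian is bounded on the compact tube; the mean value inequality applies because its time
sections are balls. -/
lemma exists_isLipschitzOnTube [ProperSpace E] (hT : 0 ≤ T) (hr : 0 ≤ r)
    (hy : ContinuousOn y (Icc 0 T))
    (hc : ContinuousOn (fun p : ℝ × E => f p.1 p.2) (closedTube T r y))
    (hd : ∀ p ∈ closedTube T r y, DifferentiableAt ℝ (f p.1) p.2)
    (hf' : ContinuousOn (fun p : ℝ × E => fderiv ℝ (f p.1) p.2) (closedTube T r y)) :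
    ∃ L, 0 ≤ L ∧ IsLipschitzOnTube T r L f y := by
  obtain ⟨L, hL⟩ := (isCompact_closedTube hy r).exists_bound_of_continuousOn hf'
  refine ⟨L, (norm_nonneg _).trans (hL (0, y 0) ⟨⟨le_rfl, hT⟩, by simpa using hr⟩), hc,
    fun t ht a b ha hb => ?_⟩
  exact (convex_closedBall (y t) r).norm_image_sub_le_of_norm_fderiv_le (𝕜 := ℝ)
    (fun x hx => hd (t, x) ⟨ht, mem_closedBall_iff_norm.1 hx⟩)
    (fun x hx => hL (t, x) ⟨ht, mem_closedBall_iff_norm.1 hx⟩)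
    (mem_closedBall_iff_norm.2 hb) (mem_closedBall_iff_norm.2 ha)

/-- First order Taylor expansion along a curve, uniformly in the parameter. -/
lemma exists_norm_sub_sub_fderiv_le [ProperSpace E] (hr : 0 < r) (hy : ContinuousOn y (Icc 0 T))
    (hd : ∀ p ∈ closedTube T r y, DifferentiableAt ℝ (f p.1) p.2)
    (hf' : ContinuousOn (fun p : ℝ × E => fderiv ℝ (f p.1) p.2) (closedTube T r y))
    {ε : ℝ} (hε : 0 < ε) :
    ∃ δ > 0, ∀ t ∈ Icc 0 T, ∀ x, ‖x - y t‖ ≤ δ →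
      ‖f t x - f t (y t) - fderiv ℝ (f t) (y t) (x - y t)‖ ≤ ε * ‖x - y t‖ := by
  -- Uniform continuity on the compact tube gives one `δ` for all `t`.
  have huc := (isCompact_closedTube hy r).uniformContinuousOn_of_continuous hf'
  obtain ⟨δ, hδ, hδ'⟩ := Metric.uniformContinuousOn_iff_le.1 huc ε hε
  refine ⟨min δ r, lt_min hδ hr, fun t ht x hx => ?_⟩
  have hball : ∀ v ∈ Metric.closedBall (y t) (min δ r), (t, v) ∈ closedTube T r y := fun v hv =>
    ⟨ht, (mem_closedBall_iff_norm.1 hv).trans (min_le_right _ _)⟩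
  have hyt : y t ∈ Metric.closedBall (y t) (min δ r) :=
    Metric.mem_closedBall_self (lt_min hδ hr).le
  refine (convex_closedBall (y t) (min δ r)).norm_image_sub_le_of_norm_fderiv_le' (𝕜 := ℝ)
    (fun v hv => hd (t, v) (hball v hv)) (fun v hv => ?_) hyt (mem_closedBall_iff_norm.2 hx)
  rw [← dist_eq_norm]
  refine hδ' (t, v) (hball v hv) (t, y t) (hball _ hyt) ?_
  rw [Prod.dist_eq, dist_self]
  exact max_le hδ.le (hv.out.trans (min_le_left _ _))

end Tube

/-! ### Differentiability of the solution in the initial value. -/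

section Shooting

variable {E : Type*} [NormedAddCommGroup E] [NormedSpace ℝ E]

lemma ContinuousLinearMap.map_rlIntegral {V W : Type*} [NormedAddCommGroup V] [NormedSpace ℝ V]
    [CompleteSpace V] [NormedAddCommGroup W] [NormedSpace ℝ W] [CompleteSpace W] (φ : V →L[ℝ] W)
    {β t : ℝ} (hβ : 0 < β) (ht : 0 ≤ t) {g : ℝ → V} (hg : ContinuousOn g (Icc 0 t)) :
    φ (rlIntegral β g t) = rlIntegral β (fun s => φ (g s)) t := by
  rw [rlIntegral, rlIntegral, map_smul,
    ← φ.intervalIntegral_comp_comm (intervalIntegrable_rlKernel_smul hβ ht hg)]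
  simp only [map_smul]

/-- The data of an initial value problem along whose solution `y(·, ρ₀)` the right-hand side is
continuously differentiable. -/
structure IsC1OnTube (α T r L : ℝ) (f : ℝ → E → E) (ρ₀ : E) (y : ℝ → E) : Prop where
  alpha_mem : α ∈ Ioo (0 : ℝ) 1
  nonneg : 0 ≤ T
  radius_pos : 0 < r
  lipschitz_nonneg : 0 ≤ L
  isSolution : IsCaputoSolution α T f ρ₀ y
  isLipschitz : IsLipschitzOnTube T r L f y
  differentiableAt : ∀ p ∈ closedTube T r y, DifferentiableAt ℝ (f p.1) p.2
  continuousOn_fderiv : ContinuousOn (fun p : ℝ × E => fderiv ℝ (f p.1) p.2) (closedTube T r y)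

lemma IsC1NearTrajectory.exists_isC1OnTube [ProperSpace E] {α T : ℝ} (hα : α ∈ Ioo (0 : ℝ) 1)
    (hT : 0 ≤ T) {f : ℝ → E → E} {ρ₀ : E} {y : ℝ → E} (hf : IsC1NearTrajectory T f y)
    (hy : IsCaputoSolution α T f ρ₀ y) : ∃ r L, IsC1OnTube α T r L f ρ₀ y := by
  obtain ⟨U, hU, hyU, hc, hd, hf'⟩ := hf
  obtain ⟨r, hr, hsub⟩ := exists_closedTube_subset hy.continuousOn hU hyU
  have hsub' : closedTube T r y ⊆ U ∩ Icc 0 T ×ˢ univ := fun p hp => ⟨hsub hp, hp.1, trivial⟩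
  obtain ⟨L, hL, hlip⟩ := exists_isLipschitzOnTube hT hr.le hy.continuousOn (hc.mono hsub')
    (fun p hp => hd p (hsub' hp)) (hf'.mono hsub')
  exact ⟨r, L, hα, hT, hr, hL, hy, hlip, fun p hp => hd p (hsub' hp), hf'.mono hsub'⟩

namespace IsC1OnTube

variable {α T r L : ℝ} {f : ℝ → E → E} {ρ ρ₀ : E} {y : ℝ → E}

lemma gronwallConst_pos (h : IsC1OnTube α T r L f ρ₀ y) : 0 < gronwallConst α T L := by
  linarith [two_le_gronwallConst (α := α) h.nonneg h.lipschitz_nonneg]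

lemma eventually_initial_lt (h : IsC1OnTube α T r L f ρ₀ y) {ε : ℝ} (hε : 0 < ε) :
    ∀ᶠ ρ in 𝓝 ρ₀, gronwallConst α T L * ‖ρ - ρ₀‖ < ε := by
  filter_upwards [Metric.ball_mem_nhds ρ₀ (div_pos hε h.gronwallConst_pos)] with ρ hρ
  rw [mem_ball_iff_norm, lt_div_iff₀ h.gronwallConst_pos] at hρ
  linarith

variable [CompleteSpace E]

lemma hasUniqueCaputoSolution (h : IsC1OnTube α T r L f ρ₀ y)
    (hρ : gronwallConst α T L * ‖ρ - ρ₀‖ < r) : HasUniqueCaputoSolution α T f ρ :=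
  h.isLipschitz.hasUniqueCaputoSolution h.alpha_mem h.nonneg h.lipschitz_nonneg h.isSolution hρ

lemma norm_caputoSolution_sub_le (h : IsC1OnTube α T r L f ρ₀ y)
    (hρ : gronwallConst α T L * ‖ρ - ρ₀‖ < r) {t : ℝ} (ht : t ∈ Icc 0 T) :
    ‖caputoSolution α T f ρ t - y t‖ ≤ gronwallConst α T L * ‖ρ - ρ₀‖ :=
  h.isLipschitz.norm_sub_le_of_initial h.alpha_mem h.nonneg h.lipschitz_nonneg h.isSolution
    (h.hasUniqueCaputoSolution hρ).isCaputoSolution hρ t ht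

lemma continuousOn_jacobian (h : IsC1OnTube α T r L f ρ₀ y)
    (hρ : gronwallConst α T L * ‖ρ - ρ₀‖ < r) :
    ContinuousOn (fun t => fderiv ℝ (f t) (caputoSolution α T f ρ t)) (Icc 0 T) :=
  h.continuousOn_fderiv.comp (f := fun t => (t, caputoSolution α T f ρ t))
    (continuousOn_id.prodMk (h.hasUniqueCaputoSolution hρ).isCaputoSolution.continuousOn)
    fun _ ht => ⟨ht, (h.norm_caputoSolution_sub_le hρ ht).trans hρ.le⟩

lemma hasUniqueCaputoSolution_variational (h : IsC1OnTube α T r L f ρ₀ y)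
    (hρ : gronwallConst α T L * ‖ρ - ρ₀‖ < r) :
    HasUniqueCaputoSolution α T (variationalField α T f ρ) (ContinuousLinearMap.id ℝ E) :=
  hasUniqueCaputoSolution_comp h.alpha_mem h.nonneg (h.continuousOn_jacobian hρ) _

lemma hasFDerivAt_caputoSolution [ProperSpace E] (h : IsC1OnTube α T r L f ρ₀ y) :
    HasFDerivAt (fun ρ => caputoSolution α T f ρ T) (variationalSolution α T f ρ₀ T) ρ₀ := by
  have hα := h.alpha_mem
  have hρ₀ : gronwallConst α T L * ‖ρ₀ - ρ₀‖ < r := by simpa using h.radius_pos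
  have hY₀ : EqOn (caputoSolution α T f ρ₀) y (Icc 0 T) :=
    (h.hasUniqueCaputoSolution hρ₀).eqOn h.isSolution
  set A : ℝ → E →L[ℝ] E := fun t => fderiv ℝ (f t) (caputoSolution α T f ρ₀ t) with hA
  set Φ := variationalSolution α T f ρ₀
  have hAc : ContinuousOn A (Icc 0 T) := h.continuousOn_jacobian hρ₀
  have hΦ : IsCaputoSolution α T (fun t X => (A t).comp X) (ContinuousLinearMap.id ℝ E) Φ :=
    (h.hasUniqueCaputoSolution_variational hρ₀).isCaputoSolution
  have hAΦ : ContinuousOn (fun t => (A t).comp (Φ t)) (Icc 0 T) := hAc.clm_comp hΦ.continuousOn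
  obtain ⟨M, hM⟩ := isCompact_Icc.exists_bound_of_continuousOn hAc
  have hM0 : 0 ≤ M := (norm_nonneg _).trans (hM 0 ⟨le_rfl, h.nonneg⟩)
  have hC := h.gronwallConst_pos
  have hC' : 0 < gronwallConst α T M := by
    linarith [two_le_gronwallConst (α := α) h.nonneg hM0]
  have hfy : ContinuousOn (fun s => f s (y s)) (Icc 0 T) :=
    h.isLipschitz.continuousOn_comp h.isSolution.continuousOn
      fun _ _ => by simpa using h.radius_pos.le
  refine .of_isLittleO (Asymptotics.isLittleO_iff.2 fun κ hκ => ?_)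
  obtain ⟨δ, hδ, htaylor⟩ := exists_norm_sub_sub_fderiv_le h.radius_pos h.isSolution.continuousOn
    h.differentiableAt h.continuousOn_fderiv
    -- The Taylor tolerance is `κ` divided by two Gronwall constants: one bounds `Y - y` by `‖ρ -
    -- ρ₀‖`, the other bounds the remainder by the Taylor error.
    (div_pos hκ (mul_pos hC' hC))
  filter_upwards [h.eventually_initial_lt (lt_min hδ h.radius_pos)] with ρ hρ
  have hρr := hρ.trans_le (min_le_right _ _)
  have hρδ := hρ.trans_le (min_le_left _ _)
  set Y := caputoSolution α T f ρ
  have hY : IsCaputoSolution α T f ρ Y := (h.hasUniqueCaputoSolution hρr).isCaputoSolution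
  have hYy : ∀ t ∈ Icc 0 T, ‖Y t - y t‖ ≤ gronwallConst α T L * ‖ρ - ρ₀‖ := fun t ht =>
    h.norm_caputoSolution_sub_le hρr ht
  have hfY : ContinuousOn (fun s => f s (Y s)) (Icc 0 T) :=
    h.isLipschitz.continuousOn_comp hY.continuousOn fun t ht => (hYy t ht).trans hρr.le
  have hAΦh : ContinuousOn (fun t => (A t).comp (Φ t) (ρ - ρ₀)) (Icc 0 T) :=
    hAΦ.clm_apply continuousOn_const
  have hTmem : T ∈ Icc 0 T := ⟨h.nonneg, le_rfl⟩
  set ε := κ / (gronwallConst α T M * gronwallConst α T L) with hε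
  have hε0 : 0 < ε := by positivity
  have key := norm_le_of_norm_le_add_rlIntegral (α := α) (L := M) (a := 0)
    (b := ε * (gronwallConst α T L * ‖ρ - ρ₀‖))
    (w := fun t => Y t - y t - Φ t (ρ - ρ₀))
    (g := fun s => f s (Y s) - f s (y s) - (A s).comp (Φ s) (ρ - ρ₀))
    hα.1 h.nonneg hM0 le_rfl (by positivity)
    ((hY.continuousOn.sub h.isSolution.continuousOn).sub
      (hΦ.continuousOn.clm_apply continuousOn_const))
    (fun s hs => by
      -- The integrand is `A` applied to the remainder, which Gronwall absorbs, plus the Taylor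
      -- error.
      have e : f s (Y s) - f s (y s) - (A s).comp (Φ s) (ρ - ρ₀) =
          A s (Y s - y s - Φ s (ρ - ρ₀)) +
            (f s (Y s) - f s (y s) - fderiv ℝ (f s) (y s) (Y s - y s)) := by
        simp only [hA, hY₀ hs, map_sub, ContinuousLinearMap.comp_apply]
        abel
      rw [e]
      refine (norm_add_le _ _).trans (add_le_add ?_ ?_)
      · exact ((A s).le_opNorm _).trans (mul_le_mul_of_nonneg_right (hM s hs) (norm_nonneg _))
      · exact (htaylor s hs _ ((hYy s hs).trans hρδ.le)).trans
          (mul_le_mul_of_nonneg_left (hYy s hs) hε0.le))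
    (fun t ht => by
      have sub : Icc 0 t ⊆ Icc 0 T := Icc_subset_Icc_right ht.2
      have hΦt : Φ t (ρ - ρ₀) =
          (ρ - ρ₀) + rlIntegral α (fun s => (A s).comp (Φ s) (ρ - ρ₀)) t := by
        -- Evaluation at `ρ - ρ₀` is continuous and linear, so it commutes with `I^α`.
        have := congrArg (ContinuousLinearMap.apply ℝ E (ρ - ρ₀))
          (hΦ.eq_add_rlIntegral hα hAΦ ht)
        rw [map_add, ContinuousLinearMap.map_rlIntegral _ hα.1 ht.1 (hAΦ.mono sub)] at this
        simpa using this
      rw [rlIntegral_sub (g := fun s => f s (Y s) - f s (y s)) hα.1 ht.1 ((hfY.sub hfy).mono sub) (hAΦh.mono sub),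
        rlIntegral_sub hα.1 ht.1 (hfY.mono sub) (hfy.mono sub), zero_add, hΦt,
        hY.eq_add_rlIntegral hα hfY ht, h.isSolution.eq_add_rlIntegral hα hfy ht]
      refine le_of_eq (congrArg norm ?_)
      abel) T hTmem
  rw [hY₀ hTmem]
  refine key.trans (le_of_eq ?_)
  rw [hε]
  field_simp
  ring

end IsC1OnTube

lemma ContinuousLinearMap.isInvertible_iff_det_ne_zero [FiniteDimensional ℝ E]
    (A : E →L[ℝ] E) : A.IsInvertible ↔ A.det ≠ 0 := by
  constructor
  · rintro ⟨e, rfl⟩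
    exact (LinearEquiv.isUnit_det' e.toLinearEquiv).ne_zero
  · intro hA
    exact ⟨A.toContinuousLinearEquivOfDetNeZero hA, by ext; rfl⟩

/-- The default inverse of a noninvertible map is `0`, which is a unit only in the trivial ring;
there every map is invertible. -/
lemma ContinuousLinearMap.isInvertible_of_isUnit_inverse {A : E →L[ℝ] E}
    (hA : IsUnit A.inverse) : A.IsInvertible := by
  by_contra h
  rw [ContinuousLinearMap.inverse_of_not_isInvertible h, isUnit_zero_iff] at hA
  have := subsingleton_of_zero_eq_one hA
  exact h ⟨ContinuousLinearEquiv.refl ℝ E, Subsingleton.elim _ _⟩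

lemma eventually_norm_sub_le_of_hasFDerivAt_zero {Ψ : E → E} {x₀ : E}
    (hΨ : HasFDerivAt Ψ (0 : E →L[ℝ] E) x₀)
    (hfix : Ψ x₀ = x₀) : ∀ᶠ x in 𝓝 x₀, ‖Ψ x - x₀‖ ≤ 1 / 2 * ‖x - x₀‖ := by
  have := Asymptotics.isLittleO_iff.1 hΨ.isLittleO (c := 1 / 2) (by norm_num)
  simpa [hfix] using this

end Shooting

/-! ### Iterating a map that contracts towards a point. -/

section Iteration

variable {E : Type*} [NormedAddCommGroup E]

lemma norm_iterate_sub_le {Ψ : E → E} {x₀ : E} {δ q : ℝ} (hq : q ∈ Ioo (0 : ℝ) 1)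
    (hΨ : ∀ x ∈ Metric.ball x₀ δ, ‖Ψ x - x₀‖ ≤ q * ‖x - x₀‖) {x : E}
    (hx : x ∈ Metric.ball x₀ δ) (l : ℕ) :
    Ψ^[l] x ∈ Metric.ball x₀ δ ∧ ‖Ψ^[l] x - x₀‖ ≤ q ^ l * ‖x - x₀‖ := by
  induction l with
  | zero => simpa using hx
  | succ l ih =>
    rw [Function.iterate_succ_apply']
    have h1 := hΨ _ ih.1
    refine ⟨?_, ?_⟩
    · rw [mem_ball_iff_norm]
      have h2 := mem_ball_iff_norm.1 ih.1
      nlinarith [norm_nonneg (Ψ^[l] x - x₀), hq.1, hq.2]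
    · rw [pow_succ', mul_assoc]
      exact h1.trans (mul_le_mul_of_nonneg_left ih.2 hq.1.le)

lemma tendsto_iterate_of_norm_sub_le {Ψ : E → E} {x₀ x : E} {q : ℝ} (hq : q ∈ Ioo (0 : ℝ) 1)
    (h : ∀ l : ℕ, ‖Ψ^[l] x - x₀‖ ≤ q ^ l * ‖x - x₀‖) :
    Tendsto (fun l : ℕ => Ψ^[l] x) atTop (𝓝 x₀) := by
  rw [tendsto_iff_norm_sub_tendsto_zero]
  refine squeeze_zero (fun _ => norm_nonneg _) h ?_
  simpa using (tendsto_pow_atTop_nhds_zero_of_lt_one hq.1.le hq.2).mul_const ‖x - x₀‖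

end Iteration

theorem theorem2 (m : ℕ) (α T : ℝ) (hα : α ∈ Ioo (0 : ℝ) 1) (hT : 0 < T)
    (f : ℝ → EuclideanSpace ℝ (Fin m) → EuclideanSpace ℝ (Fin m))
    (η ρs : EuclideanSpace ℝ (Fin m)) (ys : ℝ → EuclideanSpace ℝ (Fin m))
    -- `ys = y(·, ρs)` solves the terminal value problem, and `det Φ(T, ρs) ≠ 0`
    (hys : IsCaputoSolution α T f ρs ys) (hη : ys T = η)
    (hdet : (variationalSolution α T f ρs T).det ≠ 0)
    -- (i) and (ii)
    (hf : IsC1NearTrajectory T f ys)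
    (hΦ : ∀ᶠ ξ in 𝓝 ρs,
      DifferentiableAt ℝ (fun ρ => (variationalSolution α T f ρ T).inverse) ξ) :
    -- the Jacobian of the iteration map vanishes at `ρs`
    HasFDerivAt (shootingNewton α T f η)
      (0 : EuclideanSpace ℝ (Fin m) →L[ℝ] EuclideanSpace ℝ (Fin m)) ρs ∧
    ∃ δ > 0,
      -- every step of the procedure is well defined in the `δ`-ball around `ρs`
      (∀ ρ ∈ Metric.ball ρs δ,
        HasUniqueCaputoSolution α T f ρ ∧
        HasUniqueCaputoSolution α T (variationalField α T f ρ)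
          (ContinuousLinearMap.id ℝ (EuclideanSpace ℝ (Fin m))) ∧
        (variationalSolution α T f ρ T).det ≠ 0) ∧
      -- the iterates stay in the ball and converge to `ρs`, exponentially fast
      (∀ ρ₀ ∈ Metric.ball ρs δ,
        (∀ l : ℕ, (shootingNewton α T f η)^[l] ρ₀ ∈ Metric.ball ρs δ) ∧
        Tendsto (fun l : ℕ => (shootingNewton α T f η)^[l] ρ₀) atTop (𝓝 ρs)) ∧
      ∃ q ∈ Ioo (0 : ℝ) 1, ∀ ρ₀ ∈ Metric.ball ρs δ, ∀ l : ℕ,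
        ‖(shootingNewton α T f η)^[l] ρ₀ - ρs‖ ≤ q ^ l * ‖ρ₀ - ρs‖ := by
  obtain ⟨r, L, hC1⟩ := hf.exists_isC1OnTube hα hT.le hys
  have hρs : gronwallConst α T L * ‖ρs - ρs‖ < r := by simpa using hC1.radius_pos
  have hTmem : T ∈ Icc 0 T := ⟨hT.le, le_rfl⟩
  -- Uniqueness identifies the chosen solution with `ys`.
  have hη' : caputoSolution α T f ρs T = η :=
    ((hC1.hasUniqueCaputoSolution hρs).eqOn hys hTmem).trans hη
  have hinv : (variationalSolution α T f ρs T).IsInvertible :=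
    (ContinuousLinearMap.isInvertible_iff_det_ne_zero _).2 hdet
  have hfix : shootingNewton α T f η ρs = ρs := by simp [shootingNewton, hη']
  have hderiv : HasFDerivAt (shootingNewton α T f η)
      (0 : EuclideanSpace ℝ (Fin m) →L[ℝ] EuclideanSpace ℝ (Fin m)) ρs := by
    have h1 := (hasFDerivAt_id ρs).sub
      (hΦ.self_of_nhds.hasFDerivAt.clm_apply (hC1.hasFDerivAt_caputoSolution.sub_const η))
    refine h1.congr_fderiv ?_
    simp only [hη', sub_self, map_zero, add_zero]
    rw [hinv.inverse_comp_self, sub_self]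
  -- By (ii) `Φ(T, ·)⁻¹` is continuous at `ρs`, and units are open; so `det Φ(T, ρ) ≠ 0` persists
  -- near `ρs`.
  have hunit : ∀ᶠ ρ in 𝓝 ρs, IsUnit (variationalSolution α T f ρ T).inverse := by
    refine hΦ.self_of_nhds.continuousAt.eventually (Units.isOpen.mem_nhds ?_)
    obtain ⟨e, he⟩ := hinv
    exact ⟨ContinuousLinearEquiv.toUnit e.symm, by simp [← he]; rfl⟩
  obtain ⟨δ, hδ, hball⟩ := Metric.eventually_nhds_iff_ball.1
    ((hC1.eventually_initial_lt hC1.radius_pos).and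
      (hunit.and (eventually_norm_sub_le_of_hasFDerivAt_zero hderiv hfix)))
  have hq : (1 / 2 : ℝ) ∈ Ioo (0 : ℝ) 1 := by norm_num
  have hit := fun ρ₀ (hρ₀ : ρ₀ ∈ Metric.ball ρs δ) =>
    norm_iterate_sub_le hq (fun ρ hρ => (hball ρ hρ).2.2) hρ₀
  refine ⟨hderiv, δ, hδ, fun ρ hρ => ⟨hC1.hasUniqueCaputoSolution (hball ρ hρ).1,
    hC1.hasUniqueCaputoSolution_variational (hball ρ hρ).1,
    (ContinuousLinearMap.isInvertible_iff_det_ne_zero _).1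
      (ContinuousLinearMap.isInvertible_of_isUnit_inverse (hball ρ hρ).2.1)⟩,
    fun ρ₀ hρ₀ => ⟨fun l => (hit ρ₀ hρ₀ l).1,
      tendsto_iterate_of_norm_sub_le hq fun l => (hit ρ₀ hρ₀ l).2⟩,
    1 / 2, hq, fun ρ₀ hρ₀ l => (hit ρ₀ hρ₀ l).2⟩
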